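/- Let $G$ be a finite group. A map $f\colon X\to Y$ of $G$-spaces is isovariant if it is continuous, equivariant, and $G_{f(x)}=G_x$ for all $x\in X$. Let $\mathsf{isvt\text{-}Top}$ be the category of $G$-spaces and isovariant maps, together with a formal terminal object. For a chain $\mathbf H=\{H_0<\dots<H_m\}$ of subgroups of $G$ ($m\ge 0$), the linking simplex $\Delta^{\mathbf H}_G$ is the quotient of $G\times\Delta^m$ in which $(g,x)\sim(g',x)$, where $x=(t_0,\dots,t_{m-k},0,\dots,0)$ with $t_{m-k}\neq 0$, if and only if $gH_k=g'H_k$; the group $G$ acts by $g'\cdot\langle g,x\rangle=\langle g'g,x\rangle$, and $\partial\Delta^{\mathbf H}_G$ is the image of $G\times\partial\Delta^m$. Let $\mathcal I$ be the class of all inclusions $$\left(S^{n-1}\times\Delta^{\mathbf H}_G\right)\cup_{S^{n-1}\times\partial\Delta^{\mathbf H}_G}\left(D^n\times\partial\Delta^{\mathbf H}_G\right)\longrightarrow D^n\times\Delta^{\mathbf H}_G$$ with $n\ge 0$ and $\mathbf H$ a strictly increasing chain of subgroups of $G$, where $G$ acts trivially on $D^n$. Let $\mathcal I\text{-}\mathsf{inj}$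 be the class of maps of $\mathsf{isvt\text{-}Top}$ with the right lifting property with respect to $\mathcal I$, and let $\mathcal I\text{-}\mathsf{cof}$ be the class of maps with the left lifting property with respect to $\mathcal I\text{-}\mathsf{inj}$. A $G$-space $X$ is called a retract of an isovariant cell complex if the map $\emptyset\to X$ is in $\mathcal I\text{-}\mathsf{cof}$. A complete $G$-universe $\mathcal U$ is a real $G$-representation isomorphic to $V_1^{\oplus\mathbb N}\oplus\dots\oplus V_k^{\oplus\mathbb N}$, where $V_1,\dots,V_k$ are representatives of all isomorphism classes of irreducible real $G$-representations, with the colimit topology of its finite-dimensional subspaces. Let $\mathcal U$ be a complete $G$-universe, and let $X$ be a $G$-space that is a retract of an isovariant cell complex. Then there is an isovariant map $X\to\mathcal U$, and it is unique up to isovariant homotopy: for any two isovariant maps $f_0,f_1\colon X\to\mathcal U$ there is an isovariant map $F\colon X\times[0,1]\to\mathcal U$, where $G$ acts trivially on $[0,1]$, with $F(x,0)=f_0(x)$ and $F(x,1)=f_1(x)$ for all $x\in X$. -/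

import Mathlib

open CategoryTheory

universe u

namespace Isovariant

/-! ## Isovariant maps and isovariant homotopies

Throughout, `G` is a discrete group (finite in the theorem).  A `G`-space is a topological space
with an action of `G` by continuous maps. -/

/-- `f` is equivariant and preserves isotropy groups: `G_{f x} = G_x` for every `x`. -/
structure IsIsovariant (G : Type*) [Group G] {X Y : Type*} [MulAction G X] [MulAction G Y]
    (f : X → Y) : Prop where
  map_smul : ∀ (g : G) (x : X), f (g • x) = g • f x
  stabilizer_eq : ∀ x : X, MulAction.stabilizer G (f x) = MulAction.stabilizer G x

/-- There is an isovariant map `X × I → Y` restricting to `f₀` and `f₁` at the two ends.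
The action on `I = [0,1]` is trivial, so `(x, t)` has the isotropy group of `x` and isovariance of
`F : X × I → Y` says exactly that each `F (-, t)` is isovariant. -/
def IsovariantlyHomotopic (G : Type*) [Group G] {X Y : Type*} [TopologicalSpace X]
    [TopologicalSpace Y] [MulAction G X] [MulAction G Y] (f₀ f₁ : C(X, Y)) : Prop :=
  ∃ F : C(X × unitInterval, Y),
    (∀ t : unitInterval, IsIsovariant G fun x => F (x, t)) ∧
    (∀ x, F (x, 0) = f₀ x) ∧ (∀ x, F (x, 1) = f₁ x)

/-! ## The category of `G`-spaces and isovariant maps -/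

/-- A `G`-space, as an object of the isovariant category. -/
structure GSpace (G : Type u) [Group G] : Type (u + 1) where
  carrier : Type u
  [topologicalSpace : TopologicalSpace carrier]
  [mulAction : MulAction G carrier]
  [continuousConstSMul : ContinuousConstSMul G carrier]

namespace GSpace

variable {G : Type u} [Group G]

instance : CoeSort (GSpace G) (Type u) := ⟨GSpace.carrier⟩

attribute [instance] GSpace.topologicalSpace GSpace.mulAction GSpace.continuousConstSMul

/-- Morphisms of `G`-spaces in the isovariant category: continuous isovariant maps. -/
@[ext]
structure Hom (X Y : GSpace G) : Type u where
  toMap : C(X, Y)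
  isovariant : IsIsovariant G toMap

instance : Category.{u} (GSpace G) where
  Hom := Hom
  id X := ⟨ContinuousMap.id X, ⟨fun _ _ => rfl, fun _ => rfl⟩⟩
  comp f g := ⟨g.toMap.comp f.toMap,
    ⟨fun a x => by simp [f.isovariant.map_smul, g.isovariant.map_smul],
      fun x => by simp [f.isovariant.stabilizer_eq, g.isovariant.stabilizer_eq]⟩⟩

end GSpace

/-- The category `isvt-Top`: `G`-spaces and isovariant maps, together with a formal terminal
object. -/
abbrev IsvtTop (G : Type u) [Group G] : Type (u + 1) := WithTerminal (GSpace G)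

/-! ## Linking simplices -/

section LinkingSimplex

variable {G : Type u} [Group G]

/-- The relation on `G × Δⁿ` for a chain `H₀ < ⋯ < Hₙ`: `(g, x) ∼ (g', x)` iff `g Hₖ = g' Hₖ`
for some `k` such that `x = (t₀, …, t_{n-k}, 0, …, 0)`.  As the `Hₖ` increase, this amounts to
`g Hₖ = g' Hₖ` for the largest such `k`, the one with `t_{n-k} ≠ 0`.
The product of the discrete `G` with `Δⁿ` is written as a disjoint union of copies of `Δⁿ`. -/
def linkingSetoid (H : LTSeries (Subgroup G)) :
    Setoid (Σ _ : G, stdSimplex ℝ (Fin (H.length + 1))) where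
  r p q := p.2 = q.2 ∧ ∃ k : Fin (H.length + 1),
    (∀ i : Fin (H.length + 1), H.length - (k : ℕ) < (i : ℕ) → (p.2 : Fin (H.length + 1) → ℝ) i = 0) ∧
      p.1⁻¹ * q.1 ∈ H k
  iseqv :=
    { refl := fun p => ⟨rfl, 0, fun i hi => by
          have := i.2
          simp only [Fin.val_zero] at hi
          omega, by simp⟩
      symm := by
        rintro p q ⟨h, k, hk, hg⟩
        refine ⟨h.symm, k, fun i hi => h ▸ hk i hi, ?_⟩
        simpa using inv_mem hg
      trans := by
        rintro p q r ⟨h, k, hk, hg⟩ ⟨h', k', hk', hg'⟩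
        refine ⟨h.trans h', max k k', ?_, ?_⟩
        · rcases le_total k k' with hle | hle
          · rw [max_eq_right hle, h]
            exact hk'
          · rw [max_eq_left hle]
            exact hk
        · have h1 := H.monotone (le_max_left k k') hg
          have h2 := H.monotone (le_max_right k k') hg'
          have h3 := mul_mem h1 h2
          simpa [mul_assoc] using h3 }

/-- The linking simplex `Δ_G^H` of a chain of subgroups, with the quotient topology. -/
def LinkingSimplex (H : LTSeries (Subgroup G)) : Type u :=
  Quotient (linkingSetoid H)

namespace LinkingSimplex

variable (H : LTSeries (Subgroup G))

instance : TopologicalSpace (LinkingSimplex H) :=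
  inferInstanceAs (TopologicalSpace (Quotient (linkingSetoid H)))

/-- The point `⟨g, x⟩`. -/
def mk (g : G) (x : stdSimplex ℝ (Fin (H.length + 1))) : LinkingSimplex H :=
  Quotient.mk (linkingSetoid H) ⟨g, x⟩

/-- The action `g' • ⟨g, x⟩ = ⟨g' g, x⟩`. -/
instance : MulAction G (LinkingSimplex H) where
  smul g' := Quotient.map (fun p => ⟨g' * p.1, p.2⟩) (by
    rintro p q ⟨h, k, hk, hg⟩
    exact ⟨h, k, hk, by simpa [mul_assoc] using hg⟩)
  one_smul := by
    rintro ⟨g, x⟩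
    exact congrArg (fun a => mk H a x) (one_mul g)
  mul_smul := by
    rintro a b ⟨g, x⟩
    exact congrArg (fun c => mk H c x) (mul_assoc a b g)

theorem smul_mk (g' g : G) (x : stdSimplex ℝ (Fin (H.length + 1))) :
    g' • mk H g x = mk H (g' * g) x := rfl

instance : ContinuousConstSMul G (LinkingSimplex H) where
  continuous_const_smul g' := by
    have h : Continuous fun p : Σ _ : G, stdSimplex ℝ (Fin (H.length + 1)) =>
        (⟨g' * p.1, p.2⟩ : Σ _ : G, stdSimplex ℝ (Fin (H.length + 1))) :=
      continuous_sigma fun g => continuous_sigmaMk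
        (σ := fun _ : G => stdSimplex ℝ (Fin (H.length + 1))) (i := g' * g)
    exact (continuous_quotient_mk'.comp h).quotient_lift _

/-- The boundary `∂Δ_G^H`: the image of `G × ∂Δⁿ`. -/
def boundary : Set (LinkingSimplex H) :=
  {p | ∃ (g : G) (x : stdSimplex ℝ (Fin (H.length + 1))),
    (∃ i, (x : Fin (H.length + 1) → ℝ) i = 0) ∧ mk H g x = p}

theorem smul_mem_boundary (g : G) {p : LinkingSimplex H} (hp : p ∈ boundary H) :
    g • p ∈ boundary H := by
  obtain ⟨a, x, hx, rfl⟩ := hp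
  exact ⟨g * a, x, hx, rfl⟩

end LinkingSimplex

/-! ## The generating cofibrations -/

/-- The isovariant cell `Dⁿ × Δ_G^H`. -/
def Cell (n : ℕ) (H : LTSeries (Subgroup G)) : Type u :=
  Metric.closedBall (0 : EuclideanSpace ℝ (Fin n)) 1 × LinkingSimplex H

namespace Cell

variable (n : ℕ) (H : LTSeries (Subgroup G))

instance : TopologicalSpace (Cell n H) :=
  inferInstanceAs (TopologicalSpace
    (Metric.closedBall (0 : EuclideanSpace ℝ (Fin n)) 1 × LinkingSimplex H))

/-- `G` acts trivially on the disk. -/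
instance : MulAction G (Cell n H) where
  smul g p := (p.1, g • p.2)
  one_smul p := Prod.ext rfl (one_smul G p.2)
  mul_smul a b p := Prod.ext rfl (mul_smul a b p.2)

instance : ContinuousConstSMul G (Cell n H) where
  continuous_const_smul g := continuous_fst.prodMk (continuous_snd.const_smul g)

/-- The `G`-subspace `(Sⁿ⁻¹ × Δ_G^H) ∪ (Dⁿ × ∂Δ_G^H)` of `Dⁿ × Δ_G^H`.  Both pieces are closed and
their intersection is `Sⁿ⁻¹ × ∂Δ_G^H`, so this is the source of the pushout-product of
`Sⁿ⁻¹ → Dⁿ` with `∂Δ_G^H → Δ_G^H`.  For `n = 0` the sphere is empty. -/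
def boundary : SubMulAction G (Cell n H) where
  carrier := {p | (p.1 : EuclideanSpace ℝ (Fin n)) ∈ Metric.sphere (0 : EuclideanSpace ℝ (Fin n)) 1 ∨
    p.2 ∈ LinkingSimplex.boundary H}
  smul_mem' g _ hp := hp.imp id (LinkingSimplex.smul_mem_boundary H g)

instance : ContinuousConstSMul G (boundary n H) where
  continuous_const_smul g :=
    ((continuous_const_smul g).comp continuous_subtype_val).subtype_mk _

/-- The inclusion of the boundary of a cell, as a map of `G`-spaces. -/
def boundaryInclusion : GSpace.mk (G := G) (boundary n H) ⟶ GSpace.mk (G := G) (Cell n H) where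
  toMap := ⟨Subtype.val, continuous_subtype_val⟩
  isovariant := ⟨fun _ _ => rfl, fun p => (SubMulAction.stabilizer_of_subMul p).symm⟩

end Cell

end LinkingSimplex

/-- The class `𝓘` of generating cofibrations of `isvt-Top`: the boundary inclusions of all cells
`Dⁿ × Δ_G^H`, for `n ≥ 0` and all strictly increasing chains `H` of subgroups of `G`. -/
def generatingCofibrations (G : Type u) [Group G] : MorphismProperty (IsvtTop G) :=
  MorphismProperty.ofHoms fun i : ℕ × LTSeries (Subgroup G) =>
    WithTerminal.incl.map (Cell.boundaryInclusion i.1 i.2)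

/-- `𝓘-cof`: the maps with the left lifting property against `𝓘-inj`, the class of maps with the
right lifting property against `𝓘`. -/
def cofibrations (G : Type u) [Group G] : MorphismProperty (IsvtTop G) :=
  (generatingCofibrations G).rlp.llp

/-- The empty `G`-space. -/
def emptySpace (G : Type u) [Group G] : GSpace G :=
  letI : MulAction G PEmpty.{u + 1} :=
    { smul := fun _ x => x, one_smul := fun _ => rfl, mul_smul := fun _ _ _ => rfl }
  haveI : ContinuousConstSMul G PEmpty.{u + 1} := ⟨fun _ => continuous_id⟩
  GSpace.mk PEmpty.{u + 1}

instance (G : Type u) [Group G] : IsEmpty (emptySpace G) :=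
  inferInstanceAs (IsEmpty PEmpty.{u + 1})

/-- The map `∅ → X`. -/
def fromEmpty {G : Type u} [Group G] (X : GSpace G) : emptySpace G ⟶ X where
  toMap := ⟨fun x => isEmptyElim x, continuous_iff_continuousAt.2 fun x => isEmptyElim x⟩
  isovariant := ⟨fun _ x => isEmptyElim x, fun x => isEmptyElim x⟩

/-- `X` is a retract of an isovariant cell complex, i.e. the map `∅ → X` belongs to `𝓘-cof`. -/
def IsRetractOfCellComplex (G : Type u) [Group G] (X : Type u) [TopologicalSpace X] [MulAction G X]
    [ContinuousConstSMul G X] : Prop :=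
  cofibrations G (WithTerminal.incl.map (fromEmpty (GSpace.mk (G := G) X)))

/-! ## Complete universes -/

/-- `V₁, …, V_k` are representatives of the irreducible real representations of `G`: each is
irreducible, no two are isomorphic, and each irreducible representation is isomorphic to one. -/
structure IsIrrepSystem {G : Type u} [Group G] {k : ℕ} {V : Fin k → Type u}
    [∀ i, AddCommGroup (V i)] [∀ i, Module ℝ (V i)] (ρ : ∀ i, Representation ℝ G (V i)) :
    Prop where
  irreducible : ∀ i, (ρ i).IsIrreducible
  eq_of_equiv : ∀ i j, Nonempty ((ρ i).Equiv (ρ j)) → i = j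
  exists_equiv : ∀ (W : Type u) [AddCommGroup W] [Module ℝ W] (σ : Representation ℝ G W),
    σ.IsIrreducible → ∃ i, Nonempty (σ.Equiv (ρ i))

/-- The `G`-representation `U` is a complete `G`-universe: it is isomorphic to the direct sum of
countably many copies of each irreducible real representation of `G`, and its topology is the
colimit topology, in which a set is open iff its intersection with each finite-dimensional subspace
is open, equivalently iff its preimage under each linear map `ℝᵐ → U` is open. -/
structure IsCompleteUniverse (G : Type u) [Group G] (U : Type u) [AddCommGroup U] [Module ℝ U]
    [DistribMulAction G U] [TopologicalSpace U] : Prop where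
  isOpen_iff : ∀ s : Set U,
    IsOpen s ↔ ∀ (m : ℕ) (φ : (Fin m → ℝ) →ₗ[ℝ] U), IsOpen (φ ⁻¹' s)
  exists_equiv : ∃ (k : ℕ) (V : Fin k → Type u) (_ : ∀ i, AddCommGroup (V i))
    (_ : ∀ i, Module ℝ (V i)) (ρ : ∀ i, Representation ℝ G (V i)), IsIrrepSystem ρ ∧
      ∃ e : U ≃ₗ[ℝ] DirectSum (Fin k × ℕ) (fun p => V p.1),
        ∀ (g : G) (x : U) (p : Fin k × ℕ), e (g • x) p = ρ p.1 g (e x p)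

end Isovariant

/-! Both claims are lifting properties of `∅ → X`. An isovariant map `X → U` is a lift against `U →
*`. A homotopy from `f₀` to `f₁` is a lift of `(f₀, f₁)` against the endpoint map from paths of
constant isotropy to pairs of points with equal isotropy. So it suffices that these two maps lie in
`𝓘-inj` (`rlp_toStar`, `rlp_pathEndpoints`). By adjunction, each is an extension problem for
isovariant maps into `U`: from the boundary of a cell to the cell, or from (boundary × I) ∪ (cell ×
{0, 1}) to cell × I.

Such extensions exist because `U` has room to spare
(`IsCompleteUniverse.exists_isovariant_extension`). The closed part `B` is compact, so its image
spans a finite-dimensional invariant subspace `W`. Tietze extension and averaging over `G` give an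
equivariant extension `F₁` into `W`, whose isotropy may be too large off `B`. To cut it down, add `φ
∘ h`. Here `h` is an equivariant map to the regular representation that vanishes on `B` and has the
correct isotropy off `B`, and `φ` embeds the regular representation in `U` with image meeting `W`
only in 0. Such a `φ` exists since every irreducible occurs infinitely often in `U`. On a cell, `h`
is a function vanishing exactly on `B` times the indicator function of the coset `g H₀`, scaled by a
coordinate. -/

namespace Isovariant

/-! ## The regular representation inside a complete universe -/

section Algebra

open scoped MonoidAlgebra

variable {G : Type u} [Group G]

/-- A simple module over the real group algebra is one of the given irreducible representations. -/
theorem IsIrrepSystem.exists_injective_of_isSimpleModule {k : ℕ} {V : Fin k → Type u}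
    [∀ i, AddCommGroup (V i)] [∀ i, Module ℝ (V i)] {ρ : ∀ i, Representation ℝ G (V i)}
    (hρ : IsIrrepSystem ρ) (M : Type u) [AddCommGroup M] [Module ℝ[G] M]
    (hM : IsSimpleModule ℝ[G] M) :
    ∃ (i : Fin k) (ψ : M →+ V i), Function.Injective ψ ∧
      (∀ (c : ℝ) (m : M), ψ (algebraMap ℝ ℝ[G] c • m) = c • ψ m) ∧
      ∀ (g : G) (m : M), ψ (MonoidAlgebra.of ℝ G g • m) = ρ i g (ψ m) := by
  let : Module ℝ M := Module.restrictScalars ℝ ℝ[G] M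
  have : IsScalarTower ℝ ℝ[G] M := IsScalarTower.restrictScalars ℝ ℝ[G] M
  have hirr : (Representation.ofModule' (k := ℝ) (G := G) M).IsIrreducible :=
    (Representation.isSimpleModule_iff_irreducible_ofModule M).1 hM
  obtain ⟨i, ⟨E⟩⟩ := hρ.exists_equiv M _ hirr
  exact ⟨i, E.toLinearMap.toAddMonoidHom, EquivLike.injective E, E.toLinearMap.map_smul,
    fun g => LinearMap.congr_fun (E.isIntertwining' g)⟩

/-- The regular representation of a finite group has a jointly injective finite family of
equivariant maps to the members of a system of irreducible representations. -/
theorem IsIrrepSystem.exists_jointly_injective [Finite G] {k : ℕ} {V : Fin k → Type u}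
    [∀ i, AddCommGroup (V i)] [∀ i, Module ℝ (V i)] {ρ : ∀ i, Representation ℝ G (V i)}
    (hρ : IsIrrepSystem ρ) :
    ∃ (n : ℕ) (j : Fin n → Fin k) (ψ : ∀ i, ℝ[G] →ₗ[ℝ] V (j i)),
      (∀ i g a, ψ i (MonoidAlgebra.of ℝ G g * a) = ρ (j i) g (ψ i a)) ∧
      ∀ a, (∀ i, ψ i a = 0) → a = 0 := by
  -- Maschke: the order of `G` is invertible in `ℝ`, so the group algebra is a finite direct sum of
  -- simple modules.
  have : NeZero (Nat.card G : ℝ) := ⟨by exact_mod_cast Nat.card_pos.ne'⟩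
  obtain ⟨n, S, e, hS⟩ := IsSemisimpleModule.exists_linearEquiv_fin_dfinsupp ℝ[G] ℝ[G]
  choose j ψ hinj hsmul hψ using fun i => hρ.exists_injective_of_isSimpleModule (S i) (hS i)
  have he (a b : ℝ[G]) (i : Fin n) : e (a * b) i = a • e b i := by
    rw [← smul_eq_mul, map_smul, DFinsupp.smul_apply]
  refine ⟨n, j, fun i =>
    { toFun a := ψ i (e a i)
      map_add' a b := by rw [map_add, DFinsupp.add_apply, map_add]
      map_smul' c a := by rw [Algebra.smul_def, he, hsmul, RingHom.id_apply] },
    fun i g a => ?_, fun a ha => e.map_eq_zero_iff.1 (DFinsupp.ext fun i => ?_)⟩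
  · change ψ i (e _ i) = _
    rw [he, hψ]
    rfl
  · exact (map_eq_zero_iff _ (hinj i)).1 (ha i)

/-- Functions on a finite group, as elements of the group algebra. -/
noncomputable def funEquivMonoidAlgebra (G : Type u) [Finite G] : (G → ℝ) ≃ₗ[ℝ] ℝ[G] :=
  (Finsupp.linearEquivFunOnFinite ℝ ℝ G).symm.trans (MonoidAlgebra.coeffLinearEquiv ℝ).symm

theorem funEquivMonoidAlgebra_translate [Finite G] (g : G) (c : G → ℝ) :
    funEquivMonoidAlgebra G (fun a => c (g⁻¹ * a)) =
      MonoidAlgebra.of ℝ G g * funEquivMonoidAlgebra G c := by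
  ext a
  rw [MonoidAlgebra.of_apply, MonoidAlgebra.coeff_single_mul_apply, one_mul]
  rfl

variable {U : Type u} [AddCommGroup U] [Module ℝ U] [DistribMulAction G U] [TopologicalSpace U]

/-- A `DistribMulAction` is only additive; real linearity of the action is read off from the `ρ i`
through the coordinates. -/
theorem IsCompleteUniverse.smulCommClass (hU : IsCompleteUniverse G U) : SMulCommClass G ℝ U where
  smul_comm g c x := by
    obtain ⟨k, V, _, _, ρ, -, e, he⟩ := hU.exists_equiv
    refine e.injective (DFinsupp.ext fun p => ?_)
    rw [he, e.map_smul, e.map_smul, DirectSum.smul_apply, DirectSum.smul_apply, he, map_smul]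

/-- The regular representation embeds in a complete universe away from any given finite-dimensional
subspace. -/
theorem IsCompleteUniverse.exists_regular_disjoint [Finite G] (hU : IsCompleteUniverse G U)
    (W : Submodule ℝ U) [FiniteDimensional ℝ W] :
    ∃ φ : (G → ℝ) →ₗ[ℝ] U, (∀ g c, φ (fun a => c (g⁻¹ * a)) = g • φ c) ∧
      ∀ c, φ c ∈ W → c = 0 := by
  classical
  obtain ⟨k, V, _, _, ρ, hρ, e, he⟩ := hU.exists_equiv
  obtain ⟨n, j, ψ, hψ, hψ0⟩ := hρ.exists_jointly_injective
  obtain ⟨s, hs⟩ := (Submodule.fg_iff_finiteDimensional W).2 inferInstance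
  -- `N` exceeds every copy number occurring in the generators of `W`, so `W` has no component in
  -- copies `N, N + 1, …`.
  let N : ℕ := s.sup fun x => (DFinsupp.support (e x)).sup fun p => p.2 + 1
  have hN : ∀ w ∈ W, ∀ p : Fin k × ℕ, N ≤ p.2 → e w p = 0 := by
    intro w hw p hp
    rw [← hs] at hw
    induction hw using Submodule.span_induction with
    | mem x hx =>
      by_contra hne
      have h1 : p.2 + 1 ≤ (DFinsupp.support (e x)).sup fun p => p.2 + 1 :=
        Finset.le_sup (f := fun p : Fin k × ℕ => p.2 + 1) (DFinsupp.mem_support_iff.2 hne)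
      have h2 : ((DFinsupp.support (e x)).sup fun p => p.2 + 1) ≤ N :=
        Finset.le_sup (f := fun x => (DFinsupp.support (e x)).sup fun p => p.2 + 1) hx
      omega
    | zero => simp
    | add x y _ _ hx hy => rw [map_add, DirectSum.add_apply, hx, hy, add_zero]
    | smul c x _ hx => rw [map_smul, DirectSum.smul_apply, hx, smul_zero]
  -- The `i`-th simple summand goes to copy number `N + i`: the shift by `N` avoids `W`, and the
  -- shift by `i` separates isomorphic summands.
  let q (i : Fin n) : Fin k × ℕ := (j i, N + i)
  have hq : Function.Injective q := fun i i' h => Fin.ext (by simpa [q] using congrArg Prod.snd h)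
  let Φ : (G → ℝ) →ₗ[ℝ] DirectSum (Fin k × ℕ) (fun p => V p.1) :=
    (∑ i, DirectSum.lof ℝ _ (fun p : Fin k × ℕ => V p.1) (q i) ∘ₗ ψ i) ∘ₗ
      (funEquivMonoidAlgebra G).toLinearMap
  have hΦ (c : G → ℝ) : Φ c = ∑ i, DirectSum.lof ℝ _ (fun p : Fin k × ℕ => V p.1) (q i)
      (ψ i (funEquivMonoidAlgebra G c)) := by
    simp [Φ]
  have hΦq (c : G → ℝ) (i : Fin n) : Φ c (q i) = ψ i (funEquivMonoidAlgebra G c) := by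
    rw [hΦ, DirectSum.sum_apply, Finset.sum_eq_single i, DirectSum.lof_apply]
    · intro i' _ hne
      rw [DirectSum.lof_eq_of, DirectSum.of_eq_of_ne _ _ _ (fun h => hne (hq h.symm))]
    · simp
  refine ⟨e.symm.toLinearMap ∘ₗ Φ, fun g c => ?_, fun c hc => ?_⟩
  · refine e.injective (DFinsupp.ext fun p => ?_)
    refine Eq.trans ?_ (he g _ p).symm
    simp only [LinearMap.comp_apply, LinearEquiv.coe_coe, LinearEquiv.apply_symm_apply]
    by_cases hp : ∃ i, q i = p
    · obtain ⟨i, rfl⟩ := hp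
      rw [hΦq, hΦq, funEquivMonoidAlgebra_translate, hψ]
    · have h0 (c : G → ℝ) : Φ c p = 0 := by
        rw [hΦ, DirectSum.sum_apply]
        refine Finset.sum_eq_zero fun i _ => ?_
        rw [DirectSum.lof_eq_of, DirectSum.of_eq_of_ne _ _ _ (fun h => hp ⟨i, h.symm⟩)]
      rw [h0, h0, map_zero]
  · refine (funEquivMonoidAlgebra G).map_eq_zero_iff.1 (hψ0 _ fun i => ?_)
    rw [← hΦq]
    simpa using hN _ hc (q i) (Nat.le_add_right _ _)

end Algebra

section Topology

variable {G : Type u} [Group G] {U : Type u} [AddCommGroup U] [Module ℝ U] [DistribMulAction G U]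
  [TopologicalSpace U]

/-! ## The colimit topology of a complete universe -/

namespace IsCompleteUniverse

theorem continuous_of_fin (hU : IsCompleteUniverse G U) {m : ℕ} (φ : (Fin m → ℝ) →ₗ[ℝ] U) :
    Continuous φ :=
  ⟨fun s hs => (hU.isOpen_iff s).1 hs m φ⟩

/-- Open sets are tested on linear maps from `ℝᵐ`, and composing such a map with `L` gives another
one. -/
theorem continuous_end (hU : IsCompleteUniverse G U) (L : U →ₗ[ℝ] U) : Continuous L :=
  ⟨fun s hs => (hU.isOpen_iff _).2 fun m φ => (hU.isOpen_iff s).1 hs m (L ∘ₗ φ)⟩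

theorem continuous_functional (hU : IsCompleteUniverse G U) (l : U →ₗ[ℝ] ℝ) : Continuous l :=
  ⟨fun _ hs => (hU.isOpen_iff _).2 fun _ φ =>
    hs.preimage (LinearMap.continuous_of_finiteDimensional (l ∘ₗ φ))⟩

theorem continuousConstSMul (hU : IsCompleteUniverse G U) : ContinuousConstSMul G U where
  continuous_const_smul g :=
    have := hU.smulCommClass
    hU.continuous_end (DistribSMul.toLinearMap ℝ U g)

/-- A compact subset of a complete universe lies in a finite-dimensional subspace: otherwise some
linear functional would be unbounded on it. -/
theorem finiteDimensional_span (hU : IsCompleteUniverse G U) {K : Set U} (hK : IsCompact K) :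
    FiniteDimensional ℝ (Submodule.span ℝ K) := by
  obtain ⟨b, hbK, hspan, hb⟩ := exists_linearIndependent ℝ K
  rw [← hspan]
  by_cases hfin : b.Finite
  · exact FiniteDimensional.span_of_finite ℝ hfin
  exfalso
  have : Infinite b := Set.infinite_coe_iff.2 hfin
  let x : ℕ ↪ b := Infinite.natEmbedding b
  have hx : LinearIndependent ℝ fun n => (x n : U) := hb.comp x x.injective
  -- The functional takes the value `n` at the `n`-th of infinitely many independent points of `K`.
  -- Being linear it is continuous, hence bounded on `K`, a contradiction.
  obtain ⟨l, hl⟩ := LinearMap.exists_extend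
    ((Module.Basis.span hx).constr ℝ fun n : ℕ => (n : ℝ))
  have hln (n : ℕ) : l (x n) = n := by
    have h := LinearMap.congr_fun hl (Module.Basis.span hx n)
    rw [Module.Basis.constr_basis, LinearMap.comp_apply, Submodule.subtype_apply,
      Module.Basis.span_apply] at h
    exact h
  obtain ⟨C, hC⟩ := (hK.image (hU.continuous_functional l)).bddAbove
  obtain ⟨n, hn⟩ := exists_nat_gt C
  have h := hC ⟨x n, hbK (x n).2, rfl⟩
  rw [hln] at h
  linarith

/-- A map into a finite-dimensional subspace is continuous once its composites with all linear
functionals are. -/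
theorem continuous_of_functionals (hU : IsCompleteUniverse G U) {E : Type*} [TopologicalSpace E]
    (W : Submodule ℝ U) [FiniteDimensional ℝ W] {F : E → U} (hF : ∀ x, F x ∈ W)
    (hl : ∀ l : U →ₗ[ℝ] ℝ, Continuous fun x => l (F x)) : Continuous F := by
  let b := Module.finBasis ℝ W
  choose l hlb using fun i => LinearMap.exists_extend (b.coord i)
  have hFx : F = fun x => (Fintype.linearCombination ℝ fun i => (b i : U)) fun i => l i (F x) := by
    funext x
    have h := congrArg W.subtype (b.sum_repr ⟨F x, hF x⟩)
    rw [map_sum] at h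
    simp only [map_smul, Submodule.subtype_apply] at h
    rw [Fintype.linearCombination_apply, ← h]
    refine Finset.sum_congr rfl fun i _ => ?_
    congr 1
    rw [h]
    exact (LinearMap.congr_fun (hlb i) ⟨F x, hF x⟩).symm
  rw [hFx]
  exact (hU.continuous_of_fin _).comp (continuous_pi fun i => hl (l i))

/-- Tietze extension for continuous maps from a compact Hausdorff space to a complete universe. -/
theorem exists_extension (hU : IsCompleteUniverse G U) {E : Type*} [TopologicalSpace E]
    [CompactSpace E] [T2Space E] {B : Set E} (hB : IsClosed B) {f : E → U}
    (hf : ContinuousOn f B) :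
    ∃ F : E → U, (∀ x ∈ B, F x = f x) ∧ (∀ x, F x ∈ Submodule.span ℝ (f '' B)) ∧
      ∀ l : U →ₗ[ℝ] ℝ, Continuous fun x => l (F x) := by
  have : FiniteDimensional ℝ (Submodule.span ℝ (f '' B)) :=
    hU.finiteDimensional_span (hB.isCompact.image_of_continuousOn hf)
  set W := Submodule.span ℝ (f '' B)
  let b := Module.finBasis ℝ W
  choose l hlb using fun i => LinearMap.exists_extend (b.coord i)
  -- Real-valued Tietze extension, one coordinate of `W` at a time.
  have hext (i) : ∃ c : C(E, ℝ), ∀ x ∈ B, c x = l i (f x) := by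
    obtain ⟨c, hc⟩ := ContinuousMap.exists_restrict_eq hB
      ⟨B.domRestrict fun x => l i (f x),
        ((hU.continuous_functional (l i)).comp_continuousOn hf).domRestrict⟩
    exact ⟨c, fun x hx => DFunLike.congr_fun hc ⟨x, hx⟩⟩
  choose c hc using hext
  refine ⟨fun x => ∑ i, c i x • (b i : U), fun x hx => ?_,
    fun x => W.sum_mem fun i _ => W.smul_mem _ (b i).2, fun l => ?_⟩
  · have hfx : f x ∈ W := Submodule.subset_span ⟨x, hx, rfl⟩
    have h := congrArg W.subtype (b.sum_repr ⟨f x, hfx⟩)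
    rw [map_sum] at h
    refine Eq.trans (Finset.sum_congr rfl fun i _ => ?_) h
    rw [hc i x hx, map_smul]
    exact congrArg (· • (b i : U)) (LinearMap.congr_fun (hlb i) ⟨f x, hfx⟩)
  · simp only [map_sum, map_smul, smul_eq_mul]
    exact continuous_finsetSum _ fun i _ => (c i).continuous.mul continuous_const

/-! ## Extension of isovariant maps into a complete universe -/

/-- Let `B` be a closed invariant subset of a compact Hausdorff `G`-space `E` such that some
equivariant map from `E` to the regular representation vanishes on `B` and is isovariant off `B`.
Then isovariant maps from `B` to a complete universe extend to isovariant maps on `E`. -/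
theorem exists_isovariant_extension [Finite G] (hU : IsCompleteUniverse G U) {E : Type*}
    [TopologicalSpace E] [CompactSpace E] [T2Space E] [MulAction G E] [ContinuousConstSMul G E]
    {B : Set E} (hB : IsClosed B) (hGB : ∀ (g : G), ∀ x ∈ B, g • x ∈ B)
    {h : E → G → ℝ} (hcont : Continuous h) (hequiv : ∀ g x a, h (g • x) a = h x (g⁻¹ * a))
    (hzero : ∀ x ∈ B, h x = 0) (hfree : ∀ x ∉ B, ∀ g : G, h (g • x) = h x → g • x = x)
    {f : E → U} (hf : ContinuousOn f B) (hfequiv : ∀ g : G, ∀ x ∈ B, f (g • x) = g • f x)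
    (hfstab : ∀ g : G, ∀ x ∈ B, g • f x = f x → g • x = x) :
    ∃ F : C(E, U), IsIsovariant G F ∧ ∀ x ∈ B, F x = f x := by
  cases nonempty_fintype G
  have := hU.smulCommClass
  obtain ⟨F₀, hF₀B, hF₀W, hF₀l⟩ := hU.exists_extension hB hf
  have : FiniteDimensional ℝ (Submodule.span ℝ (f '' B)) :=
    hU.finiteDimensional_span (hB.isCompact.image_of_continuousOn hf)
  set W := Submodule.span ℝ (f '' B)
  have hGW (g : G) (w : U) (hw : w ∈ W) : g • w ∈ W := by
    induction hw using Submodule.span_induction with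
    | mem w hw =>
      obtain ⟨x, hx, rfl⟩ := hw
      exact Submodule.subset_span ⟨g • x, hGB g x hx, hfequiv g x hx⟩
    | zero => rw [smul_zero]; exact W.zero_mem
    | add v w _ _ hv hw => rw [smul_add]; exact W.add_mem hv hw
    | smul c w _ hw => rw [smul_comm]; exact W.smul_mem c hw
  -- Averaging over `G` makes the extension equivariant and leaves it unchanged on `B`, where `f`
  -- already is.
  let F₁ (x : E) : U := (Fintype.card G : ℝ)⁻¹ • ∑ g : G, g⁻¹ • F₀ (g • x)
  have hF₁W (x : E) : F₁ x ∈ W := W.smul_mem _ (W.sum_mem fun g _ => hGW _ _ (hF₀W _))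
  have hF₁ (g : G) (x : E) : F₁ (g • x) = g • F₁ x := by
    simp only [F₁]
    rw [smul_comm g, Finset.smul_sum (r := g)]
    congr 1
    exact Fintype.sum_equiv (Equiv.mulRight g) _ _ fun a => by simp [smul_smul]
  have hF₁B (x : E) (hx : x ∈ B) : F₁ x = f x := by
    have h1 (g : G) : g⁻¹ • F₀ (g • x) = f x := by
      rw [hF₀B _ (hGB g x hx), hfequiv g x hx, inv_smul_smul]
    simp only [F₁, h1, Finset.sum_const, Finset.card_univ]
    rw [← Nat.cast_smul_eq_nsmul ℝ, smul_smul, inv_mul_cancel₀, one_smul]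
    exact_mod_cast Fintype.card_ne_zero
  obtain ⟨φ, hφ, hφW⟩ := hU.exists_regular_disjoint W
  let F (x : E) : U := F₁ x + φ (h x)
  have hFcont : Continuous F := by
    -- Addition on `U` is not assumed continuous, so continuity is checked on functionals, inside a
    -- finite-dimensional subspace.
    refine hU.continuous_of_functionals (W ⊔ LinearMap.range φ)
      (fun x => Submodule.add_mem_sup (hF₁W x) ⟨_, rfl⟩) fun l => ?_
    simp only [F, F₁, map_add, map_smul, map_sum, smul_eq_mul]
    refine Continuous.add (continuous_const.mul (continuous_finsetSum _ fun g _ => ?_))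
      ((LinearMap.continuous_of_finiteDimensional (l ∘ₗ φ)).comp hcont)
    exact (hF₀l (l ∘ₗ DistribSMul.toLinearMap ℝ U g⁻¹)).comp (continuous_const_smul g)
  have hFB (x : E) (hx : x ∈ B) : F x = f x := by
    simp only [F, hzero x hx, map_zero, add_zero, hF₁B x hx]
  have hFequiv (g : G) (x : E) : F (g • x) = g • F x := by
    simp only [F]
    rw [smul_add, hF₁, ← hφ, ← funext (hequiv g x)]
  refine ⟨⟨F, hFcont⟩, ⟨hFequiv, fun x => ?_⟩, hFB⟩
  ext g
  simp only [MulAction.mem_stabilizer_iff, ContinuousMap.coe_mk]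
  refine ⟨fun hg => ?_, fun hg => by rw [← hFequiv, hg]⟩
  by_cases hx : x ∈ B
  · rw [hFB x hx] at hg
    exact hfstab g x hx hg
  -- If `g` fixes `F x`, then `φ (h (g • x) - h x)` equals a difference of values of `F₁`, which
  -- lies in `W`; hence `h (g • x) = h x`.
  · refine hfree x hx g (sub_eq_zero.1 (hφW _ ?_))
    rw [← hFequiv] at hg
    have h1 : φ (h (g • x) - h x) = F₁ x - F₁ (g • x) := by
      rw [map_sub, sub_eq_sub_iff_add_eq_add, add_comm, add_comm (F₁ x) (φ (h x)),
        add_comm (φ (h x))]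
      exact hg
    rw [h1]
    exact W.sub_mem (hF₁W _) (hF₁W _)

end IsCompleteUniverse

end Topology

section LinkingSimplexTopology

variable {G : Type u} [Group G]

/-! ## Linking simplices are compact Hausdorff -/

namespace LinkingSimplex

variable (H : LTSeries (Subgroup G))

/-- The underlying point `x` of `⟨g, x⟩`. -/
def coord : LinkingSimplex H → stdSimplex ℝ (Fin (H.length + 1)) :=
  Quotient.lift Sigma.snd fun _ _ h => h.1

theorem coord_smul (g : G) (p : LinkingSimplex H) : coord H (g • p) = coord H p := by
  obtain ⟨b, x⟩ := p
  rfl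

theorem continuous_coord : Continuous (coord H) :=
  (continuous_sigma fun _ => continuous_id).quotient_lift _

open Classical in
/-- The multiple by the coordinate `t_{n-k}` of the indicator function of the coset `g Hₖ`, for the
point `⟨g, (t₀, …, tₙ)⟩`. -/
noncomputable def cosetFun (k : Fin (H.length + 1)) : LinkingSimplex H → G → ℝ :=
  Quotient.lift (fun p a => if p.1⁻¹ * a ∈ H k then p.2 k.rev else 0) (by
    rintro ⟨g, x⟩ ⟨g', x'⟩ ⟨hx, k', hk', hg⟩
    obtain rfl : x = x' := hx
    funext a
    dsimp only at hk' hg ⊢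
    -- If `k < k'`, the coordinate used is among those forced to vanish; otherwise `H k' ≤ H k` and
    -- the two cosets of `H k` agree.
    rcases lt_or_ge k k' with hlt | hle
    · have h0 : x k.rev = 0 := hk' _ (by rw [Fin.val_rev]; omega)
      simp only [h0, ite_self]
    · have h1 : g⁻¹ * g' ∈ H k := H.monotone hle hg
      have h2 : g⁻¹ * a = (g⁻¹ * g') * (g'⁻¹ * a) := by group
      rw [h2, Subgroup.mul_mem_cancel_left _ h1])

open Classical in
theorem cosetFun_mk (k : Fin (H.length + 1)) (g : G) (x : stdSimplex ℝ (Fin (H.length + 1)))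
    (a : G) : cosetFun H k (mk H g x) a = if g⁻¹ * a ∈ H k then x k.rev else 0 := rfl

theorem cosetFun_smul (k : Fin (H.length + 1)) (g : G) (p : LinkingSimplex H) (a : G) :
    cosetFun H k (g • p) a = cosetFun H k p (g⁻¹ * a) := by
  obtain ⟨b, x⟩ := p
  change cosetFun H k (mk H (g * b) x) a = cosetFun H k (mk H b x) (g⁻¹ * a)
  rw [cosetFun_mk, cosetFun_mk, mul_inv_rev, mul_assoc]

theorem continuous_cosetFun (k : Fin (H.length + 1)) : Continuous (cosetFun H k) := by
  refine Continuous.quotient_lift (continuous_sigma fun g => continuous_pi fun a => ?_) _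
  by_cases h : g⁻¹ * a ∈ H k
  · simp only [h, if_true]
    exact (continuous_apply _).comp continuous_subtype_val
  · simp only [h, if_false]
    exact continuous_const

/-- A point is determined by its coordinates and the coset belonging to the last nonzero one. -/
theorem eq_of_cosetFun_eq {p q : LinkingSimplex H} (hx : coord H p = coord H q)
    (k : Fin (H.length + 1)) (hk : coord H p k.rev ≠ 0)
    (hlast : ∀ i, k.rev < i → coord H p i = 0) (h : cosetFun H k p = cosetFun H k q) : p = q := by
  obtain ⟨g, x⟩ := p
  obtain ⟨g', x'⟩ := q
  obtain rfl : x = x' := hx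
  have h1 : cosetFun H k (mk H g x) g' = cosetFun H k (mk H g' x) g' := congrFun h g'
  rw [cosetFun_mk, cosetFun_mk, inv_mul_cancel, if_pos (one_mem _)] at h1
  refine Quotient.sound ⟨rfl, k, fun i hi => hlast i ?_, ?_⟩
  · rw [Fin.lt_def, Fin.val_rev]
    omega
  · by_contra hg
    rw [if_neg hg] at h1
    exact hk h1.symm

/-- The coordinates and all the coset functions jointly separate points: the last nonzero coordinate
selects the coset function that determines the point. -/
instance : T2Space (LinkingSimplex H) := by
  refine T2Space.of_injective_continuous
    (f := fun p => (coord H p, fun k => cosetFun H k p)) (fun p q h => ?_)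
    ((continuous_coord H).prodMk (continuous_pi (continuous_cosetFun H)))
  obtain ⟨hx, hc⟩ := Prod.ext_iff.1 h
  have hne : (Finset.univ.filter fun i => coord H p i ≠ 0).Nonempty := by
    by_contra hempty
    rw [Finset.not_nonempty_iff_eq_empty, Finset.filter_eq_empty_iff] at hempty
    have hsum : ∑ i, coord H p i = 1 := (coord H p).2.2
    rw [Finset.sum_eq_zero fun i hi => not_not.1 (hempty hi)] at hsum
    exact zero_ne_one hsum
  set i := Finset.max' _ hne with hi
  refine eq_of_cosetFun_eq H hx i.rev ?_ (fun j hj => ?_) (congrFun hc _)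
  · rw [Fin.rev_rev]
    exact (Finset.mem_filter.1 (Finset.max'_mem _ hne)).2
  · rw [Fin.rev_rev] at hj
    by_contra h0
    exact (Finset.le_max' _ j (Finset.mem_filter.2 ⟨Finset.mem_univ j, h0⟩)).not_gt hj

instance [Finite G] : CompactSpace (LinkingSimplex H) :=
  inferInstanceAs (CompactSpace (Quotient (linkingSetoid H)))

theorem mem_boundary_iff {p : LinkingSimplex H} : p ∈ boundary H ↔ ∏ i, coord H p i = 0 := by
  rw [Finset.prod_eq_zero_iff]
  constructor
  · rintro ⟨g, x, ⟨i, hi⟩, rfl⟩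
    exact ⟨i, Finset.mem_univ i, hi⟩
  · rintro ⟨i, -, hi⟩
    obtain ⟨g, x⟩ := p
    exact ⟨g, x, ⟨i, hi⟩, rfl⟩

/-- Off the boundary, the isotropy group of `⟨g, x⟩` is that of the indicator function of
`g H₀`. -/
theorem smul_eq_of_cosetFun_eq {p : LinkingSimplex H} (hp : p ∉ boundary H) {g : G}
    (h : cosetFun H 0 (g • p) = cosetFun H 0 p) : g • p = p := by
  rw [mem_boundary_iff, Finset.prod_eq_zero_iff] at hp
  -- Index 0 corresponds to the last coordinate, which is nonzero off the boundary and has none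
  -- after it.
  refine eq_of_cosetFun_eq H (coord_smul H g p) 0 (fun h0 => ?_) (fun i hi => absurd hi ?_) h
  · rw [coord_smul] at h0
    exact hp ⟨_, Finset.mem_univ _, h0⟩
  · rw [Fin.rev_zero]
    exact (Fin.le_last i).not_gt

end LinkingSimplex

/-! ## Extension over a cell -/

namespace Cell

variable (n : ℕ) (H : LTSeries (Subgroup G))

instance : T2Space (Cell n H) :=
  inferInstanceAs (T2Space
    (Metric.closedBall (0 : EuclideanSpace ℝ (Fin n)) 1 × LinkingSimplex H))

instance [Finite G] : CompactSpace (Cell n H) :=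
  have : CompactSpace (Metric.closedBall (0 : EuclideanSpace ℝ (Fin n)) 1) :=
    isCompact_iff_compactSpace.1 (isCompact_closedBall _ _)
  inferInstanceAs (CompactSpace
    (Metric.closedBall (0 : EuclideanSpace ℝ (Fin n)) 1 × LinkingSimplex H))

/-- A function on the cell that vanishes exactly on the boundary. -/
noncomputable def weight (p : Cell n H) : ℝ :=
  (1 - ‖(p.1 : EuclideanSpace ℝ (Fin n))‖) * ∏ i, LinkingSimplex.coord H p.2 i

theorem continuous_weight : Continuous (weight n H) := by
  have h1 : Continuous fun p : Cell n H => p.1 := continuous_fst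
  have h2 : Continuous fun p : Cell n H => LinkingSimplex.coord H p.2 :=
    (LinkingSimplex.continuous_coord H).comp continuous_snd
  refine (continuous_const.sub (continuous_subtype_val.comp h1).norm).mul
    (continuous_finsetProd _ fun i _ => ?_)
  exact (continuous_apply i).comp (continuous_subtype_val.comp h2)

theorem weight_smul (g : G) (p : Cell n H) : weight n H (g • p) = weight n H p := by
  have h := LinkingSimplex.coord_smul H g p.2
  change _ * ∏ i, LinkingSimplex.coord H (g • p.2) i = _
  rw [h]
  rfl

theorem weight_eq_zero_iff {p : Cell n H} : weight n H p = 0 ↔ p ∈ boundary n H := by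
  rw [weight, mul_eq_zero, ← LinkingSimplex.mem_boundary_iff, sub_eq_zero, eq_comm,
    ← mem_sphere_zero_iff_norm]
  rfl

variable {U : Type u} [AddCommGroup U] [Module ℝ U] [DistribMulAction G U] [TopologicalSpace U]

/-- An isovariant map to a complete universe extends from the union of the two faces
`∂ (Dⁿ × Δ_G^H) × T` and `(Dⁿ × Δ_G^H) × τ⁻¹(0)` of `(Dⁿ × Δ_G^H) × T`, for `T` a compact Hausdorff
space with trivial action and `τ` a real function on it. -/
theorem exists_isovariant_extension [Finite G] (hU : IsCompleteUniverse G U) {T : Type*}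
    [TopologicalSpace T] [CompactSpace T] [T2Space T] {τ : T → ℝ} (hτ : Continuous τ)
    {f : Cell n H × T → U}
    (hf : ContinuousOn f {p | p.1 ∈ boundary n H ∨ τ p.2 = 0})
    (hfequiv : ∀ (g : G) (c : Cell n H) (t : T), (c ∈ boundary n H ∨ τ t = 0) →
      f (g • c, t) = g • f (c, t))
    (hfstab : ∀ (g : G) (c : Cell n H) (t : T), (c ∈ boundary n H ∨ τ t = 0) →
      g • f (c, t) = f (c, t) → g • c = c) :
    ∃ F : C(Cell n H × T, U), (∀ t, IsIsovariant G fun c => F (c, t)) ∧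
      ∀ (c : Cell n H) (t : T), (c ∈ boundary n H ∨ τ t = 0) → F (c, t) = f (c, t) := by
  let : MulAction G T :=
    { smul _ t := t
      one_smul _ := rfl
      mul_smul _ _ _ := rfl }
  have hT (g : G) (t : T) : g • t = t := rfl
  have : ContinuousConstSMul G T := ⟨fun _ => continuous_id⟩
  -- The scalar factor is invariant and vanishes exactly on the two faces; off them it can be
  -- cancelled, leaving the coset function to detect isotropy.
  let h (p : Cell n H × T) (a : G) : ℝ :=
    τ p.2 * weight n H p.1 * LinkingSimplex.cosetFun H 0 p.1.2 a
  have hset : {p : Cell n H × T | p.1 ∈ boundary n H ∨ τ p.2 = 0} =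
      {p | τ p.2 * weight n H p.1 = 0} := by
    ext p
    rw [Set.mem_ofPred_eq, Set.mem_ofPred_eq, mul_eq_zero, weight_eq_zero_iff, or_comm]
  have hcw : Continuous fun p : Cell n H × T => τ p.2 * weight n H p.1 :=
    (hτ.comp continuous_snd).mul ((continuous_weight n H).comp continuous_fst)
  have hsnd : Continuous fun p : Cell n H × T => p.1.2 :=
    (continuous_snd (X := Metric.closedBall (0 : EuclideanSpace ℝ (Fin n)) 1)).comp
      continuous_fst
  have hequiv (g : G) (p : Cell n H × T) (a : G) : h (g • p) a = h p (g⁻¹ * a) := by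
    change τ p.2 * weight n H (g • p.1) * LinkingSimplex.cosetFun H 0 (g • p.1.2) a = _
    rw [weight_smul, LinkingSimplex.cosetFun_smul]
  have hzero : ∀ p ∈ {p : Cell n H × T | p.1 ∈ boundary n H ∨ τ p.2 = 0}, h p = 0 := by
    intro p hp
    rw [hset] at hp
    funext a
    change τ p.2 * weight n H p.1 * _ = 0
    rw [show τ p.2 * weight n H p.1 = 0 from hp, zero_mul]
  have hfree : ∀ p ∉ {p : Cell n H × T | p.1 ∈ boundary n H ∨ τ p.2 = 0}, ∀ g : G,
      h (g • p) = h p → g • p = p := by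
    intro p hp g hg
    have hp1 : p.1.2 ∉ LinkingSimplex.boundary H := fun h => hp (Or.inl (Or.inr h))
    rw [hset] at hp
    refine Prod.ext (Prod.ext rfl (LinkingSimplex.smul_eq_of_cosetFun_eq H hp1 ?_)) rfl
    funext a
    have h1 : τ p.2 * weight n H (g • p.1) * LinkingSimplex.cosetFun H 0 (g • p.1.2) a =
      τ p.2 * weight n H p.1 * LinkingSimplex.cosetFun H 0 p.1.2 a := congrFun hg a
    rw [weight_smul] at h1
    exact mul_left_cancel₀ hp h1
  obtain ⟨F, hF, hFf⟩ := hU.exists_isovariant_extension (E := Cell n H × T)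
    (hset ▸ isClosed_singleton.preimage hcw)
    (fun g p hp => hp.imp (fun hp => (boundary n H).smul_mem g hp) id)
    (continuous_pi fun a => hcw.mul ((continuous_apply a).comp
      ((LinkingSimplex.continuous_cosetFun H 0).comp hsnd)))
    hequiv hzero hfree hf (fun g p => hfequiv g p.1 p.2)
    (fun g p hp hg => Prod.ext (hfstab g p.1 p.2 hp hg) rfl)
  refine ⟨F, fun t => ⟨fun g c => hF.map_smul g (c, t), fun c => ?_⟩, fun c t => hFf (c, t)⟩
  rw [hF.stabilizer_eq]
  ext g
  simp only [MulAction.mem_stabilizer_iff, Prod.smul_mk, hT, Prod.mk.injEq, and_true]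

end Cell

end LinkingSimplexTopology

section Lifting

variable {G : Type u} [Group G]

/-! ## Lifting problems in the category with a formal terminal object -/

/-- The inclusion of `GSpace G` is fully faithful and squares over the terminal object commute
automatically. -/
theorem hasLiftingProperty_star_iff {A B P : GSpace G} (i : A ⟶ B) :
    HasLiftingProperty (WithTerminal.incl.map i)
      (WithTerminal.starTerminal.from (WithTerminal.incl.obj P)) ↔
      ∀ a : A ⟶ P, ∃ l : B ⟶ P, i ≫ l = a := by
  constructor
  · intro h a
    have sq : CommSq (WithTerminal.incl.map a) (WithTerminal.incl.map i)
      (WithTerminal.starTerminal.from (WithTerminal.incl.obj P))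
      (WithTerminal.starTerminal.from (WithTerminal.incl.obj B)) :=
      ⟨WithTerminal.starTerminal.hom_ext _ _⟩
    refine ⟨WithTerminal.incl.preimage sq.lift, WithTerminal.incl.map_injective ?_⟩
    rw [Functor.map_comp, Functor.map_preimage, sq.fac_left]
  · refine fun h => ⟨fun {a b} _ => ?_⟩
    obtain ⟨l, hl⟩ := h (WithTerminal.incl.preimage a)
    refine ⟨⟨⟨WithTerminal.incl.map l, ?_, WithTerminal.starTerminal.hom_ext _ _⟩⟩⟩
    rw [← Functor.map_comp, hl, Functor.map_preimage]

theorem hasLiftingProperty_incl_iff {A B P Q : GSpace G} (i : A ⟶ B) (p : P ⟶ Q) :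
    HasLiftingProperty (WithTerminal.incl.map i) (WithTerminal.incl.map p) ↔
      ∀ (a : A ⟶ P) (b : B ⟶ Q), a ≫ p = i ≫ b → ∃ l : B ⟶ P, i ≫ l = a ∧ l ≫ p = b := by
  constructor
  · intro h a b hab
    have sq : CommSq (WithTerminal.incl.map a) (WithTerminal.incl.map i)
      (WithTerminal.incl.map p) (WithTerminal.incl.map b) :=
      ⟨by rw [← Functor.map_comp, hab, Functor.map_comp]⟩
    refine ⟨WithTerminal.incl.preimage sq.lift, WithTerminal.incl.map_injective ?_,
      WithTerminal.incl.map_injective ?_⟩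
    · rw [Functor.map_comp, Functor.map_preimage, sq.fac_left]
    · rw [Functor.map_comp, Functor.map_preimage, sq.fac_right]
  · refine fun h => ⟨fun {a b} sq => ?_⟩
    obtain ⟨l, hl, hl'⟩ := h (WithTerminal.incl.preimage a) (WithTerminal.incl.preimage b)
      (WithTerminal.incl.map_injective (by
        rw [Functor.map_comp, Functor.map_comp, Functor.map_preimage, Functor.map_preimage, sq.w]))
    refine ⟨⟨⟨WithTerminal.incl.map l, ?_, ?_⟩⟩⟩
    · rw [← Functor.map_comp, hl, Functor.map_preimage]
    · rw [← Functor.map_comp, hl', Functor.map_preimage]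

theorem IsIsovariant.smul_eq_iff {X Y : Type*} [MulAction G X] [MulAction G Y] {f : X → Y}
    (hf : IsIsovariant G f) (g : G) (x : X) : g • f x = f x ↔ g • x = x := by
  rw [← MulAction.mem_stabilizer_iff, hf.stabilizer_eq, MulAction.mem_stabilizer_iff]

/-! ## Isovariant paths -/

/-- The pairs of points of `U` with the same isotropy group. -/
def isovariantPairs (G : Type u) [Group G] (U : Type u) [MulAction G U] : SubMulAction G (U × U) where
  carrier := {p | ∀ g : G, g • p.1 = p.1 ↔ g • p.2 = p.2}
  smul_mem' a p hp g := by
    -- `g` fixes `a • x` exactly when `a⁻¹ * g * a` fixes `x`.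
    have h1 := hp (a⁻¹ * g * a)
    rwa [mul_smul, mul_smul, inv_smul_eq_iff, mul_smul, mul_smul, inv_smul_eq_iff] at h1

theorem smul_isovariantPair_eq_iff {U : Type u} [MulAction G U]
    (p : isovariantPairs G U) (g : G) :
    g • p = p ↔ g • p.1.1 = p.1.1 := by
  refine ⟨fun h => congrArg (fun p : isovariantPairs G U => p.1.1) h, fun h => ?_⟩
  exact Subtype.ext (Prod.ext h ((p.2 g).1 h))

variable (G) (U : Type u) [TopologicalSpace U] [MulAction G U] [ContinuousConstSMul G U]

/-- The paths in `U` along which the isotropy group is constant. -/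
def isovariantPaths : SubMulAction G C(unitInterval, U) where
  carrier := {γ | ∀ (s t : unitInterval) (g : G), g • γ s = γ s → g • γ t = γ t}
  smul_mem' a γ hγ s t g h := by
    have h1 := hγ s t (a⁻¹ * g * a) (by
      rw [mul_smul, mul_smul, inv_smul_eq_iff]
      exact h)
    rwa [mul_smul, mul_smul, inv_smul_eq_iff] at h1

instance : ContinuousConstSMul G (isovariantPaths G U) where
  continuous_const_smul g :=
    ((continuous_const_smul g).comp continuous_subtype_val).subtype_mk _

instance : ContinuousConstSMul G (isovariantPairs G U) where
  continuous_const_smul g :=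
    ((continuous_const_smul g).comp continuous_subtype_val).subtype_mk _

variable {G U}

/-- Constancy of isotropy along the path makes evaluation at each time isovariant. -/
theorem smul_isovariantPath_eq_iff (γ : isovariantPaths G U) (t : unitInterval) (g : G) :
    g • γ = γ ↔ g • γ.1 t = γ.1 t := by
  refine ⟨fun h => congrArg (fun γ : isovariantPaths G U => γ.1 t) h, fun h => ?_⟩
  exact Subtype.ext (ContinuousMap.ext fun s => γ.2 t s g h)

variable (G U)

/-- The endpoints of an isovariant path. -/
def pathEndpoints : GSpace.mk (G := G) (isovariantPaths G U) ⟶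
    GSpace.mk (G := G) (isovariantPairs G U) where
  toMap := ⟨fun γ => ⟨(γ.1 0, γ.1 1), fun g => ⟨γ.2 0 1 g, γ.2 1 0 g⟩⟩, by
    refine Continuous.subtype_mk (Continuous.prodMk ?_ ?_) _
    · exact (continuous_eval_const 0).comp continuous_subtype_val
    · exact (continuous_eval_const 1).comp continuous_subtype_val⟩
  isovariant :=
    { map_smul _ _ := rfl
      stabilizer_eq γ := by
        ext g
        rw [MulAction.mem_stabilizer_iff, MulAction.mem_stabilizer_iff,
          smul_isovariantPath_eq_iff γ 0]
        exact smul_isovariantPair_eq_iff _ g }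

end Lifting

/-! ### Lifting properties of a complete universe and of its endpoint map -/

section Universe

variable {G : Type u} [Group G] [Finite G] {U : Type u} [AddCommGroup U] [Module ℝ U]
  [DistribMulAction G U] [TopologicalSpace U] [ContinuousConstSMul G U]

/-- The map from a complete universe to the formal terminal object is in `𝓘-inj`. -/
theorem IsCompleteUniverse.rlp_toStar (hU : IsCompleteUniverse G U) :
    (generatingCofibrations G).rlp (WithTerminal.starTerminal.from
      (WithTerminal.incl.obj (GSpace.mk (G := G) U))) := by
  rintro _ _ _ ⟨n, H⟩
  refine (hasLiftingProperty_star_iff _).2 fun a => ?_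
  classical
  let f (p : Cell n H × PUnit.{1}) : U :=
    if hp : p.1 ∈ Cell.boundary n H then a.toMap ⟨p.1, hp⟩ else 0
  have hfa (c : Cell n H) (hc : c ∈ Cell.boundary n H) (t : PUnit) :
      f (c, t) = a.toMap ⟨c, hc⟩ := dif_pos hc
  have hB {c : Cell n H} (h : c ∈ Cell.boundary n H ∨ (1 : ℝ) = 0) : c ∈ Cell.boundary n H :=
    h.resolve_right one_ne_zero
  -- With `T` a point and `τ = 1` the second face is empty; the default 0 of `f` off the boundary
  -- plays no role.
  obtain ⟨F, hF, hFf⟩ := Cell.exists_isovariant_extension n H hU (T := PUnit.{1}) (τ := fun _ => 1)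
    continuous_const (f := f) (by
      rw [continuousOn_iff_continuous_domRestrict]
      have h1 : Continuous fun p : {p : Cell n H × PUnit.{1} |
          p.1 ∈ Cell.boundary n H ∨ (1 : ℝ) = 0} =>
          a.toMap (⟨p.1.1, hB p.2⟩ : Cell.boundary n H) :=
        a.toMap.continuous.comp
          ((continuous_fst.comp continuous_subtype_val).subtype_mk fun p => hB p.2)
      exact h1.congr fun p => (hfa _ (hB p.2) _).symm)
    (fun g c t h => by
      rw [hfa c (hB h), hfa _ ((Cell.boundary n H).smul_mem g (hB h))]
      exact a.isovariant.map_smul g ⟨c, hB h⟩)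
    (fun g c t h hg => by
      rw [hfa c (hB h)] at hg
      exact congrArg Subtype.val ((a.isovariant.smul_eq_iff g _).1 hg))
  refine ⟨⟨F.comp ⟨fun c => (c, PUnit.unit), by fun_prop⟩, hF PUnit.unit⟩, GSpace.Hom.ext
    (ContinuousMap.ext fun c => ?_)⟩
  exact (hFf c.1 _ (Or.inl c.2)).trans (hfa c.1 c.2 _)

/-- The endpoint map of the isovariant paths in a complete universe is in `𝓘-inj`. -/
theorem IsCompleteUniverse.rlp_pathEndpoints (hU : IsCompleteUniverse G U) :
    (generatingCofibrations G).rlp (WithTerminal.incl.map (pathEndpoints G U)) := by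
  rintro _ _ _ ⟨n, H⟩
  refine (hasLiftingProperty_incl_iff _ _).2 fun a b hab => ?_
  classical
  have hab' (c : Cell.boundary n H) : ((a.toMap c).1 0, (a.toMap c).1 1) = (b.toMap c.1).1 :=
    congrArg (fun m : GSpace.mk (G := G) (Cell.boundary n H) ⟶
      GSpace.mk (G := G) (isovariantPairs G U) => (m.toMap c).1) hab
  -- Off the boundary only the values at times 0 and 1 matter; the last branch is arbitrary at
  -- intermediate times.
  let f (p : Cell n H × unitInterval) : U :=
    if hp : p.1 ∈ Cell.boundary n H then (a.toMap ⟨p.1, hp⟩).1 p.2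
    else if p.2 = 0 then (b.toMap p.1).1.1 else (b.toMap p.1).1.2
  have hfa (c : Cell n H) (hc : c ∈ Cell.boundary n H) (t : unitInterval) :
      f (c, t) = (a.toMap ⟨c, hc⟩).1 t := dif_pos hc
  have hf0 (c : Cell n H) : f (c, 0) = (b.toMap c).1.1 := by
    by_cases hc : c ∈ Cell.boundary n H
    · rw [hfa c hc]
      exact congrArg Prod.fst (hab' ⟨c, hc⟩)
    · simp [f, hc]
  have hf1 (c : Cell n H) : f (c, 1) = (b.toMap c).1.2 := by
    by_cases hc : c ∈ Cell.boundary n H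
    · rw [hfa c hc]
      exact congrArg Prod.snd (hab' ⟨c, hc⟩)
    · simp [f, hc]
  have hτ {t : unitInterval} : (t : ℝ) * (1 - t) = 0 ↔ t = 0 ∨ t = 1 := by
    rw [mul_eq_zero, sub_eq_zero, eq_comm (a := (1 : ℝ))]
    simp
  have hb1 : Continuous fun c : Cell n H => (b.toMap c).1.1 :=
    continuous_fst.comp (continuous_subtype_val.comp b.toMap.continuous)
  have hb2 : Continuous fun c : Cell n H => (b.toMap c).1.2 :=
    continuous_snd.comp (continuous_subtype_val.comp b.toMap.continuous)
  have hbdry : IsClosed {p : Cell n H × unitInterval | p.1 ∈ Cell.boundary n H} := by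
    have h1 : {p : Cell n H × unitInterval | p.1 ∈ Cell.boundary n H} =
        {p | Cell.weight n H p.1 = 0} := Set.ext fun p => (Cell.weight_eq_zero_iff n H).symm
    rw [h1]
    exact isClosed_singleton.preimage ((Cell.continuous_weight n H).comp continuous_fst)
  have hclosed (s : unitInterval) : IsClosed {p : Cell n H × unitInterval | p.2 = s} :=
    isClosed_singleton.preimage continuous_snd
  have hcont : ContinuousOn f {p | p.1 ∈ Cell.boundary n H ∨ (p.2 : ℝ) * (1 - p.2) = 0} := by
    have hset : {p : Cell n H × unitInterval |
        p.1 ∈ Cell.boundary n H ∨ (p.2 : ℝ) * (1 - p.2) = 0} =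
        {p | p.1 ∈ Cell.boundary n H} ∪ ({p | p.2 = 0} ∪ {p | p.2 = 1}) :=
      Set.ext fun p => or_congr_right hτ
    rw [hset]
    refine ContinuousOn.union_of_isClosed ?_ (ContinuousOn.union_of_isClosed ?_ ?_
      (hclosed 0) (hclosed 1)) hbdry ((hclosed 0).union (hclosed 1))
    · rw [continuousOn_iff_continuous_domRestrict]
      have h1 : Continuous fun p : {p : Cell n H × unitInterval | p.1 ∈ Cell.boundary n H} =>
          (a.toMap (⟨p.1.1, p.2⟩ : Cell.boundary n H)).1 p.1.2 :=
        (continuous_subtype_val.comp (a.toMap.continuous.comp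
          ((continuous_fst.comp continuous_subtype_val).subtype_mk fun p => p.2))).eval
          (continuous_snd.comp continuous_subtype_val)
      exact h1.congr fun p => (hfa _ p.2 _).symm
    · refine (hb1.comp continuous_fst).continuousOn.congr ?_
      rintro ⟨c, _⟩ rfl
      exact hf0 c
    · refine (hb2.comp continuous_fst).continuousOn.congr ?_
      rintro ⟨c, _⟩ rfl
      exact hf1 c
  -- The function `t * (1 - t)` vanishes exactly at the two ends of the interval.
  obtain ⟨F, hF, hFf⟩ := Cell.exists_isovariant_extension n H hU (T := unitInterval)
    (τ := fun t => t * (1 - t)) (by fun_prop) (f := f) hcont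
    (by
      rintro g c t (hc | ht)
      · rw [hfa c hc, hfa _ ((Cell.boundary n H).smul_mem g hc)]
        exact congrArg (fun γ : isovariantPaths G U => γ.1 t) (a.isovariant.map_smul g ⟨c, hc⟩)
      · have h1 := b.isovariant.map_smul g c
        rcases hτ.1 ht with rfl | rfl
        · rw [hf0, hf0]
          exact congrArg (fun p : isovariantPairs G U => p.1.1) h1
        · rw [hf1, hf1]
          exact congrArg (fun p : isovariantPairs G U => p.1.2) h1)
    (by
      rintro g c t (hc | ht) hg
      · rw [hfa c hc, ← smul_isovariantPath_eq_iff] at hg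
        exact congrArg Subtype.val ((a.isovariant.smul_eq_iff g _).1 hg)
      · refine (b.isovariant.smul_eq_iff g c).1 ((smul_isovariantPair_eq_iff _ g).2 ?_)
        rcases hτ.1 ht with rfl | rfl
        · rwa [hf0] at hg
        · rw [hf1] at hg
          exact ((b.toMap c).2 g).2 hg)
  have hFpath (c : Cell n H) : F.curry c ∈ isovariantPaths G U := fun s t g h =>
    ((hF t).smul_eq_iff g c).2 (((hF s).smul_eq_iff g c).1 h)
  refine ⟨⟨⟨fun c => ⟨F.curry c, hFpath c⟩, F.curry.continuous.subtype_mk hFpath⟩,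
    ⟨fun g c => Subtype.ext (ContinuousMap.ext fun t => (hF t).map_smul g c), fun c => ?_⟩⟩,
    GSpace.Hom.ext (ContinuousMap.ext fun c => Subtype.ext (ContinuousMap.ext fun t => ?_)),
    GSpace.Hom.ext (ContinuousMap.ext fun c => Subtype.ext (Prod.ext ?_ ?_))⟩
  · ext g
    rw [MulAction.mem_stabilizer_iff, MulAction.mem_stabilizer_iff]
    exact (smul_isovariantPath_eq_iff _ 0 g).trans ((hF 0).smul_eq_iff g c)
  · exact (hFf c.1 t (Or.inl c.2)).trans (hfa c.1 c.2 t)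
  · exact (hFf c 0 (Or.inr (hτ.2 (Or.inl rfl)))).trans (hf0 c)
  · exact (hFf c 1 (Or.inr (hτ.2 (Or.inr rfl)))).trans (hf1 c)

end Universe

end Isovariant

/-! ### Existence and uniqueness up to isovariant homotopy -/

theorem corollary6p5 (G : Type u) [Group G] [Finite G]
    (U : Type u) [AddCommGroup U] [Module ℝ U] [DistribMulAction G U] [TopologicalSpace U]
    (hU : Isovariant.IsCompleteUniverse G U)
    (X : Type u) [TopologicalSpace X] [MulAction G X] [ContinuousConstSMul G X]
    (hX : Isovariant.IsRetractOfCellComplex G X) :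
    (∃ f : C(X, U), Isovariant.IsIsovariant G f) ∧
      ∀ f₀ f₁ : C(X, U), Isovariant.IsIsovariant G f₀ → Isovariant.IsIsovariant G f₁ →
        Isovariant.IsovariantlyHomotopic G f₀ f₁ := by
  have := hU.continuousConstSMul
  refine ⟨?_, fun f₀ f₁ h₀ h₁ => ?_⟩
  · obtain ⟨l, -⟩ := (Isovariant.hasLiftingProperty_star_iff _).1 (hX _ hU.rlp_toStar)
      (Isovariant.fromEmpty (Isovariant.GSpace.mk (G := G) U))
    exact ⟨l.toMap, l.isovariant⟩
  · have hmem (x : X) : (f₀ x, f₁ x) ∈ Isovariant.isovariantPairs G U := fun g =>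
      (h₀.smul_eq_iff g x).trans (h₁.smul_eq_iff g x).symm
    let b : Isovariant.GSpace.mk (G := G) X ⟶
        Isovariant.GSpace.mk (G := G) (Isovariant.isovariantPairs G U) :=
      { toMap := ⟨fun x => ⟨(f₀ x, f₁ x), hmem x⟩,
          (f₀.continuous.prodMk f₁.continuous).subtype_mk hmem⟩
        isovariant := ⟨fun g x => Subtype.ext (Prod.ext (h₀.map_smul g x) (h₁.map_smul g x)),
          fun x => by
            ext g
            rw [MulAction.mem_stabilizer_iff, MulAction.mem_stabilizer_iff]
            exact (Isovariant.smul_isovariantPair_eq_iff _ g).trans (h₀.smul_eq_iff g x)⟩ }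
    -- The lift assigns to `x` a path from `f₀ x` to `f₁ x`; its adjoint is the homotopy.
    obtain ⟨l, -, hl⟩ := (Isovariant.hasLiftingProperty_incl_iff _ _).1
      (hX _ hU.rlp_pathEndpoints) (Isovariant.fromEmpty _) b
      (Isovariant.GSpace.Hom.ext (ContinuousMap.ext fun x => isEmptyElim x))
    have hlb (x : X) : ((l.toMap x).1 0, (l.toMap x).1 1) = (f₀ x, f₁ x) :=
      congrArg (fun m : Isovariant.GSpace.mk (G := G) X ⟶
        Isovariant.GSpace.mk (G := G) (Isovariant.isovariantPairs G U) => (m.toMap x).1) hl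
    refine ⟨⟨fun p => (l.toMap p.1).1 p.2, ?_⟩, fun t => ⟨fun g x => ?_, fun x => ?_⟩,
      fun x => congrArg Prod.fst (hlb x), fun x => congrArg Prod.snd (hlb x)⟩
    · exact (continuous_subtype_val.comp (l.toMap.continuous.comp continuous_fst)).eval
        continuous_snd
    · exact congrArg (fun γ : Isovariant.isovariantPaths G U => γ.1 t)
        (l.isovariant.map_smul g x)
    · ext g
      rw [MulAction.mem_stabilizer_iff, MulAction.mem_stabilizer_iff]
      exact (Isovariant.smul_isovariantPath_eq_iff _ t g).symm.trans
        (l.isovariant.smul_eq_iff g x)
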